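/- Definitions. A metric space $\mathrm M$ is *homogeneous* if every isometry from a finite subspace of $\mathrm M$ onto a subspace of $\mathrm M$ extends to an isometry of $\mathrm M$ onto $\mathrm M$. A homogeneous metric space $\mathrm M$ whose set of distances is exactly $\mathcal D\subseteq\mathbb R_{\ge 0}$ is a *Urysohn metric space* for $\mathcal D$ if every finite metric space with distances in $\mathcal D$ has an isometry into $\mathrm M$; the set $\mathcal D$ is *universal* if such a space exists, and $\mathfrak U_{\mathcal D}$ is the class of countable Urysohn metric spaces for $\mathcal D$. Let $\mathcal D\ni 0$ be finite. A *block* of $\mathcal D$ is a set $\mathcal B=\{b_0<b_1<\dots<b_n\}\subseteq\mathcal D\setminus\{0\}$ $(n\ge 0)$ of consecutive elements of $\mathcal D$ such that $b_0>2\max\big(\mathcal D\cap[0,b_0)\big)$ and $b_{i+1}\le b_i+b_0$ for all $i<n$, and which is maximal under inclusion among the sets with these properties. A *copy* of $\mathrm M$ in $\mathrm M$ is the image of an isometry of $\mathrm M$ into $\mathrm M$. Lemma 9.2. Let $\mathcal D\subseteq\mathbb R_{\ge0}$ be a finite universal set that has at least two blocks, let $\mathcal B$ be its first block, i.e. the block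 with $\min\mathcal B=\min(\mathcal D\setminus\{0\})$, and let $\mathbf m=\max\mathcal B$. Let $\mathrm M=(M,\mathrm d)\in\mathfrak U_{\mathcal D}$. Then the relation $x\sim y\iff \mathrm d(x,y)\le\mathbf m$ is an equivalence relation on $M$, and for every colouring $\chi:M\to\{0,1\}$ there is a copy $\mathrm C$ of $\mathrm M$ in $\mathrm M$ such that every $\sim$-equivalence class of $\mathrm C$ is monochromatic, that is, for each $x\in C$ the colouring $\chi$ is constant on $\{y\in C:\mathrm d(x,y)\le\mathbf m\}$. -/

import Mathlib

/-- A metric space is homogeneous if every isometry of a finite subspace of `M` onto a subspace of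
`M` extends to an isometry of `M` onto `M`. -/
def IsHomogeneousMetric (M : Type*) [MetricSpace M] : Prop :=
  ∀ (F : Set M), F.Finite → ∀ f : F → M, Isometry f →
    ∃ g : M ≃ᵢ M, ∀ x : F, g (x : M) = f x

/-- The set of distances between points of a metric space. -/
def distSet (M : Type*) [MetricSpace M] : Set ℝ :=
  {r | ∃ x y : M, dist x y = r}

/-- `M` is an Urysohn metric space with distance set `D`: it is homogeneous, its set of distances is
exactly `D`, and every finite metric space with distances in `D` has an isometry into `M`.
A set `D` is universal precisely when such a space exists. -/
structure IsUrysohnSpace (D : Set ℝ) (M : Type*) [MetricSpace M] : Prop where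
  homogeneous : IsHomogeneousMetric M
  distSet_eq : distSet M = D
  embeds : ∀ (N : Type) [MetricSpace N] [Finite N], distSet N ⊆ D → ∃ f : N → M, Isometry f

/-- `p` is the largest number in `D ∩ [0, r)`. -/
def IsPrevIn (D : Set ℝ) (r p : ℝ) : Prop := IsGreatest (D ∩ Set.Ico 0 r) p

/-- `s` is the smallest number in `D` larger than `r`. -/
def IsNextIn (D : Set ℝ) (r s : ℝ) : Prop := IsLeast (D ∩ Set.Ioi r) s

/-- `B` is a run of consecutive elements `b 0 < b 1 < ⋯ < b n` of `D`, all positive, that begins after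
a gap (`b 0` is more than twice the preceding element of `D`) and in which consecutive elements
differ by at most `b 0`. -/
def IsBlockSegment (D B : Set ℝ) : Prop :=
  B ⊆ D ∧ ∃ (n : ℕ) (b : Fin (n + 1) → ℝ), Set.range b = B ∧
    0 < b 0 ∧
    (∃ p, IsPrevIn D (b 0) p ∧ p + p < b 0) ∧
    (∀ i : Fin n, b i.castSucc < b i.succ) ∧
    (∀ i : Fin n, IsNextIn D (b i.castSucc) (b i.succ)) ∧
    (∀ i : Fin n, b i.succ ≤ b i.castSucc + b 0)

/-- A block of `D` is an inclusion-maximal block segment; these are the disjoint pieces into which a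
finite universal distance set (without `0`) decomposes. -/
def IsBlock (D B : Set ℝ) : Prop := Maximal (IsBlockSegment D) B

/-- `C` is (the underlying set of) a copy of `M` in `M`: the image of an isometry of `M` into `M`. -/
def IsCopyIn (M : Type*) [MetricSpace M] (C : Set M) : Prop :=
  ∃ f : M → M, Isometry f ∧ Set.range f = C

/-!
The truncated sum `x ⊕ y = max (D ∩ [0, x + y])` of a finite universal set `D` is associative. If
`m` is the maximum of a block `b 0 < ⋯ < b n`, then `m ⊕ b 0 = m`, as there is a gap behind the
block. Hence `m ⊕ b (i + 1) ≤ m ⊕ (b i ⊕ b 0) = (m ⊕ b i) ⊕ b 0 ≤ m` by induction on `i`, so that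
`m ⊕ m = m`, and being at distance at most `m` is transitive.

For every finite colouring of `M` there even is a copy of `M` of a single colour. The words over `D`
carry a pseudometric with values in `D` for which `u` and `v c t` have distance `c` whenever `u` and
`v` have the same length and any two letters of `u` and `v` at the same position are compatible with
the distance `c`. By universality and homogeneity the words embed into `M`, so that a colouring of
`M` becomes one of words. An idempotent ultrafilter argument in the spirit of Gowers' theorem yields
a sequence of words `v n`, each containing the letter `0`, such that the products
`raise (a 0) (v 0) ⋯ raise (a (n - 1)) (v (n - 1)) * s n` all have the same colour, where `s n` is
the part of `v n` in front of its last letter `0` and `raise x` replaces each letter `y` by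
`max x y`. If `p` enumerates `M`, choosing `a i = dist (p n) (p i)` gives words `V n` with the same
mutual distances as the points `p n`: for `j < k` the letter of `V k` that comes from the last `0`
of `v j` is `dist (p k) (p j)`.
-/

open Filter FreeMonoid

/-! ### Ultrafilters of words -/

section Ultrafilter

attribute [local instance] Ultrafilter.mul Ultrafilter.semigroup

theorem continuous_ultrafilter_map {α β : Type*} (f : α → β) :
    Continuous (Ultrafilter.map f) :=
  ultrafilterBasis_is_basis.continuous_iff.2 <| by
    rintro _ ⟨s, rfl⟩
    exact ultrafilter_isOpen_basic (f ⁻¹' s)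

theorem ultrafilter_map_mul {M N F : Type*} [Mul M] [Mul N] [FunLike F M N] [MulHomClass F M N]
    (f : F) (p q : Ultrafilter M) : (p * q).map f = p.map f * q.map f :=
  Ultrafilter.coe_injective <| Filter.ext' fun P => by
    simp only [Ultrafilter.coe_map, eventually_map, Ultrafilter.eventually_mul, map_mul]

variable {S : Type*} [LinearOrder S]

/-- The endomorphism of the monoid of words over a linear order that replaces every letter `y` by
`max x y`. -/
def raise (x : S) : FreeMonoid S →* FreeMonoid S := FreeMonoid.map (max x)

theorem ultrafilter_map_raise_raise (x y : S) (q : Ultrafilter (FreeMonoid S)) :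
    (q.map (raise x)).map (raise y) = q.map (raise (max y x)) := by
  rw [Ultrafilter.map_map]
  congr 1
  funext w
  simp only [raise, Function.comp_apply, FreeMonoid.map_map]
  congr 2
  funext z
  exact (max_assoc y x z).symm

/-- The ultrafilters of words with least letter `x`. That all letters are at least `x` is expressed
by invariance under `raise x`, an identity that survives products. -/
def leastLetterUltrafilters (x : S) : Set (Ultrafilter (FreeMonoid S)) :=
  {u | (∀ᶠ w : FreeMonoid S in u, x ∈ w) ∧ u.map (raise x) = u}

theorem isClosed_leastLetterUltrafilters (x : S) : IsClosed (leastLetterUltrafilters x) :=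
  (ultrafilter_isClosed_basic {w | x ∈ w}).inter <|
    isClosed_eq (continuous_ultrafilter_map _) continuous_id

theorem mul_mem_leastLetterUltrafilters_of_right {x : S} {u v : Ultrafilter (FreeMonoid S)}
    (hu : u.map (raise x) = u) (hv : v ∈ leastLetterUltrafilters x) :
    u * v ∈ leastLetterUltrafilters x := by
  refine ⟨?_, by rw [ultrafilter_map_mul, hu, hv.2]⟩
  change ∀ᶠ w : FreeMonoid S in u, ∀ᶠ w' : FreeMonoid S in v, x ∈ w * w'
  exact Eventually.of_forall fun w => hv.1.mono fun w' hw' => mem_mul.2 (Or.inr hw')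

theorem mul_mem_leastLetterUltrafilters_of_left {x : S} {u v : Ultrafilter (FreeMonoid S)}
    (hu : u ∈ leastLetterUltrafilters x) (hv : v.map (raise x) = v) :
    u * v ∈ leastLetterUltrafilters x := by
  refine ⟨?_, by rw [ultrafilter_map_mul, hu.2, hv]⟩
  change ∀ᶠ w : FreeMonoid S in u, ∀ᶠ w' : FreeMonoid S in v, x ∈ w * w'
  exact hu.1.mono fun w hw => Eventually.of_forall fun w' => mem_mul.2 (Or.inl hw)

/-- An ultrafilter of words with least letter `x` which absorbs, when multiplied from the left, its
own images under raising to any `y ≥ x`. -/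
structure IsAbsorbing (x : S) (q : Ultrafilter (FreeMonoid S)) : Prop where
  mem_leastLetterUltrafilters : q ∈ leastLetterUltrafilters x
  map_raise_mul : ∀ y, x ≤ y → q.map (raise y) * q = q

theorem exists_isAbsorbing_of_isMax {x : S} (hx : IsMax x) :
    ∃ q : Ultrafilter (FreeMonoid S), IsAbsorbing x q := by
  obtain ⟨q, hqx, hqq⟩ := exists_idempotent_in_compact_subsemigroup
    Ultrafilter.continuous_mul_left (leastLetterUltrafilters x)
    ⟨pure (of x), by simp, by simp [raise]⟩
    (isClosed_leastLetterUltrafilters x).isCompact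
    fun u hu v hv => mul_mem_leastLetterUltrafilters_of_right hu.2 hv
  refine ⟨q, hqx, fun y hy => ?_⟩
  obtain rfl := hx.eq_of_le hy
  rw [hqx.2, hqq]

theorem exists_mem_leastLetterUltrafilters_map_raise_eq {x z : S} (hxz : x ≤ z)
    {q : Ultrafilter (FreeMonoid S)} (hq : q ∈ leastLetterUltrafilters z) :
    ∃ u ∈ leastLetterUltrafilters x, u.map (raise z) = q := by
  let lower : FreeMonoid S → FreeMonoid S := FreeMonoid.map fun t => if t ≤ z then x else t
  have raise_comp_lower (g : S → S) (y : S) (h : ∀ t, max y (if t ≤ z then x else t) = g t) :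
      raise y ∘ lower = FreeMonoid.map g := by
    rw [← funext h]
    exact (congrArg DFunLike.coe (FreeMonoid.map_comp (max y) _)).symm
  refine ⟨q.map lower, ⟨?_, ?_⟩, ?_⟩
  · exact (eventually_map.2 <| hq.1.mono fun w hw => FreeMonoid.mem_map.2 ⟨z, hw, if_pos le_rfl⟩)
  · rw [Ultrafilter.map_map, raise_comp_lower _ x fun t => ?_]
    split_ifs with ht
    exacts [max_self x, max_eq_right (hxz.trans (not_le.1 ht).le)]
  · rw [Ultrafilter.map_map, raise_comp_lower (max z) z fun t => ?_]
    · exact hq.2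
    split_ifs with ht
    exacts [(max_eq_left hxz).trans (max_eq_left ht).symm, rfl]

/-- If `K` is the set of ultrafilters `u` with least letter `x` and `u.map (raise z) = q`, then
`K * q` is a compact semigroup. For an idempotent `u * q` in it, `q * (u * q)` is absorbing: raising
to `y ≥ z` turns it into the same ultrafilter as `q`. -/
theorem exists_isAbsorbing_of_covBy {x z : S} (hxz : x ⋖ z) {q : Ultrafilter (FreeMonoid S)}
    (hq : IsAbsorbing z q) : ∃ q' : Ultrafilter (FreeMonoid S), IsAbsorbing x q' := by
  have hqz : q.map (raise z) = q := hq.mem_leastLetterUltrafilters.2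
  have hqx : q.map (raise x) = q := by
    rw [← hqz, ultrafilter_map_raise_raise, max_eq_right hxz.le]
  have hqq : q * q = q := by simpa only [hqz] using hq.map_raise_mul z le_rfl
  let K := leastLetterUltrafilters x ∩ {u | u.map (raise z) = q}
  have K_compact : IsCompact K := ((isClosed_leastLetterUltrafilters x).inter <|
    isClosed_eq (continuous_ultrafilter_map _) continuous_const).isCompact
  have mul_mem_K : ∀ u, u.map (raise x) = u → u.map (raise z) = q → ∀ v ∈ K, u * v ∈ K :=
    fun u hux huz v hv => ⟨mul_mem_leastLetterUltrafilters_of_right hux hv.1, by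
      rw [Set.mem_ofPred_eq, ultrafilter_map_mul, huz, hv.2, hqq]⟩
  obtain ⟨_, ⟨u, ⟨hux, huz⟩, rfl⟩, hidem⟩ := exists_idempotent_in_compact_subsemigroup
    Ultrafilter.continuous_mul_left ((· * q) '' K)
    (Set.Nonempty.image _ <|
      exists_mem_leastLetterUltrafilters_map_raise_eq hxz.le hq.mem_leastLetterUltrafilters)
    (K_compact.image (Ultrafilter.continuous_mul_left q)) (by
      rintro _ ⟨u, hu, rfl⟩ _ ⟨v, hv, rfl⟩
      exact ⟨u * (q * v), mul_mem_K u hu.1.2 hu.2 _ (mul_mem_K q hqx hqz v hv),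
        by simp only [mul_assoc]⟩)
  beta_reduce at hidem
  have mem_x : q * (u * q) ∈ leastLetterUltrafilters x :=
    mul_mem_leastLetterUltrafilters_of_right hqx (mul_mem_leastLetterUltrafilters_of_left hux hqx)
  have map_z : (q * (u * q)).map (raise z) = q := by
    rw [ultrafilter_map_mul, ultrafilter_map_mul, hqz, huz, hqq, hqq]
  refine ⟨q * (u * q), mem_x, fun y hy => ?_⟩
  rcases hy.eq_or_lt with rfl | hlt
  · calc (q * (u * q)).map (raise x) * (q * (u * q)) = q * (u * (q * q) * (u * q)) := by
          rw [mem_x.2]; simp only [mul_assoc]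
      _ = q * (u * q) := by rw [hqq, hidem]
  · have hzy : z ≤ y := hxz.ge_of_gt hlt
    have map_y : (q * (u * q)).map (raise y) = q.map (raise y) := by
      rw [← max_eq_left hzy, ← ultrafilter_map_raise_raise, map_z, max_eq_left hzy]
    rw [map_y, ← mul_assoc, hq.map_raise_mul y hzy]

theorem exists_isAbsorbing [Finite S] (x : S) :
    ∃ q : Ultrafilter (FreeMonoid S), IsAbsorbing x q := by
  induction x using WellFoundedGT.induction with
  | ind x ih =>
    by_cases hx : IsMax x
    · exact exists_isAbsorbing_of_isMax hx
    · obtain ⟨y, hy⟩ := not_isMax_iff.1 hx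
      obtain ⟨z, hxz, -⟩ := exists_covBy_le_of_lt hy
      obtain ⟨q, hq⟩ := ih z hxz.lt
      exact exists_isAbsorbing_of_covBy hxz hq

/-- The product `raise (a 0) (v 0) * ⋯ * raise (a (n - 1)) (v (n - 1))`. -/
def raisedProd (v : ℕ → FreeMonoid S) (a : ℕ → S) : ℕ → FreeMonoid S
  | 0 => 1
  | n + 1 => raisedProd v a n * raise (a n) (v n)

theorem IsAbsorbing.exists_word [Finite S] {b : S} (hb : IsBot b) {q : Ultrafilter (FreeMonoid S)}
    (hq : IsAbsorbing b q) {P : FreeMonoid S → Prop} {F : Set (FreeMonoid S)} (hF : F.Finite)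
    (hP : ∀ w ∈ F, ∀ᶠ u in q, P (w * u)) :
    ∃ v, b ∈ v ∧ (∀ w ∈ F, P (w * v)) ∧ ∀ w ∈ F, ∀ x, ∀ᶠ u in q, P (w * raise x v * u) := by
  have hP' : ∀ w ∈ F, ∀ x, ∀ᶠ v in q, ∀ᶠ u in q, P (w * raise x v * u) := by
    intro w hw x
    have h := hP w hw
    rw [← hq.map_raise_mul x (hb x), Ultrafilter.eventually_mul, Ultrafilter.coe_map,
      eventually_map] at h
    simpa only [mul_assoc] using h
  have hv : ∀ᶠ v in q, ∀ w ∈ F, P (w * v) := (eventually_all_finite hF).2 hP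
  have hv' : ∀ᶠ v in q, ∀ w ∈ F, ∀ x, ∀ᶠ u in q, P (w * raise x v * u) :=
    (eventually_all_finite hF).2 fun w hw => eventually_all.2 (hP' w hw)
  exact (hq.mem_leastLetterUltrafilters.1.and (hv.and hv')).exists

theorem exists_monochromatic_raisedProd [Finite S] {b : S} (hb : IsBot b) {κ : Type*} [Finite κ]
    (χ : FreeMonoid S → κ) :
    ∃ (i : κ) (v : ℕ → FreeMonoid S), (∀ n, b ∈ v n) ∧ ∀ n a, χ (raisedProd v a n * v n) = i := by
  obtain ⟨q, hq⟩ := exists_isAbsorbing b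
  obtain ⟨i, hi⟩ := Ultrafilter.eq_pure_of_finite (q.map χ)
  have hχ : ∀ᶠ u in q, χ u = i := by
    rw [← eventually_map (P := (· = i)), ← Ultrafilter.coe_map, hi]
    exact eventually_pure.2 rfl
  let State := {F : Set (FreeMonoid S) // F.Finite ∧ ∀ w ∈ F, ∀ᶠ u in q, χ (w * u) = i}
  choose v hbv hv hv' using fun F : State =>
    hq.exists_word hb (P := fun w => χ w = i) F.2.1 F.2.2
  let next : State → State := fun F =>
    ⟨Set.image2 (fun w x => w * raise x (v F)) F Set.univ, F.2.1.image2 _ Set.finite_univ, by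
      rintro _ ⟨w, hw, x, -, rfl⟩
      exact hv' F w hw x⟩
  let F : ℕ → State := fun n => next^[n] ⟨{1}, Set.finite_singleton 1, by simpa using hχ⟩
  have F_succ (n : ℕ) : F (n + 1) = next (F n) := Function.iterate_succ_apply' ..
  have raisedProd_mem (a : ℕ → S) (n : ℕ) : raisedProd (fun k => v (F k)) a n ∈ (F n).1 := by
    induction n with
    | zero => exact rfl
    | succ n ih =>
      rw [F_succ]
      exact ⟨_, ih, a n, trivial, rfl⟩
  exact ⟨i, fun n => v (F n), fun n => hbv (F n), fun n a => hv (F n) _ (raisedProd_mem a n)⟩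

theorem exists_eq_mul_of_mul_of_mem {α : Type*} {b : α} {w : FreeMonoid α} (h : b ∈ w) :
    ∃ s r, w = s * of b * r ∧ b ∉ r := by
  have h' : b ∈ w.toList.reverse := List.mem_reverse.2 h
  obtain ⟨r, s, hw, hr⟩ := List.eq_append_cons_of_mem h'
  refine ⟨ofList s.reverse, ofList r.reverse, toList.injective ?_, mt List.mem_reverse.1 hr⟩
  simpa [toList_mul] using List.reverse_eq_iff.1 hw

/-- The part of the word `w` in front of the last occurrence of the letter `b`. -/
def beforeLast {α : Type*} [DecidableEq α] (b : α) (w : FreeMonoid α) : FreeMonoid α :=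
  ofList (w.toList.rdropWhile (· ≠ b)).dropLast

theorem beforeLast_mul_of_mul {α : Type*} [DecidableEq α] {b : α} (s : FreeMonoid α)
    {r : FreeMonoid α} (hr : b ∉ r) : beforeLast b (s * of b * r) = s := by
  have h : (s * of b * r).toList.rdropWhile (· ≠ b) = s.toList ++ [b] := by
    have hr' : ∀ x ∈ r.toList.reverse, decide (x ≠ b) = true := fun x hx =>
      decide_eq_true (ne_of_mem_of_not_mem (List.mem_reverse.1 hx) hr)
    rw [toList_mul, toList_mul, toList_of, List.rdropWhile, List.reverse_append,
      List.dropWhile_append_of_pos hr']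
    simp
  rw [beforeLast, h, List.dropLast_concat, ofList_toList]

theorem exists_monochromatic_raisedProd_mul [Finite S] {b : S} (hb : IsBot b) {κ : Type*}
    [Finite κ] (χ : FreeMonoid S → κ) :
    ∃ (i : κ) (s r : ℕ → FreeMonoid S),
      ∀ n a, χ (raisedProd (fun k => s k * of b * r k) a n * s n) = i := by
  obtain ⟨i, v, hbv, hv⟩ := exists_monochromatic_raisedProd hb (χ ∘ beforeLast b)
  choose s r hw hr using fun n => exists_eq_mul_of_mul_of_mem (hbv n)
  obtain rfl : v = fun k => s k * of b * r k := funext hw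
  refine ⟨i, s, r, fun n a => ?_⟩
  rw [← hv n a, Function.comp_apply, ← mul_assoc, ← mul_assoc, beforeLast_mul_of_mul _ (hr n)]

theorem exists_raisedProd_eq_mul (v : ℕ → FreeMonoid S) (a : ℕ → S) {j k : ℕ} (h : j ≤ k) :
    ∃ t, raisedProd v a k = raisedProd v a j * t := by
  induction k, h using Nat.le_induction with
  | base => exact ⟨1, (mul_one _).symm⟩
  | succ k _ ih =>
    obtain ⟨t, ht⟩ := ih
    exact ⟨t * raise (a k) (v k), by rw [raisedProd, ht, mul_assoc]⟩

theorem exists_raisedProd_mul_eq {b : S} (hb : IsBot b) (s r : ℕ → FreeMonoid S) (a : ℕ → S)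
    {j k : ℕ} (h : j < k) :
    ∃ t, raisedProd (fun i => s i * of b * r i) a k * s k =
      raisedProd (fun i => s i * of b * r i) a j * raise (a j) (s j) * of (a j) * t := by
  obtain ⟨t, ht⟩ := exists_raisedProd_eq_mul (fun i => s i * of b * r i) a (Nat.succ_le_of_lt h)
  refine ⟨raise (a j) (r j) * t * s k, ?_⟩
  have raise_b : raise (a j) (of b) = of (a j) := congrArg of (max_eq_left (hb _))
  rw [ht, Nat.succ_eq_add_one, raisedProd]
  simp only [map_mul, raise_b, mul_assoc]

end Ultrafilter

/-! ### Associative distance sets and Urysohn spaces -/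

section TruncAdd

/-- The truncated sum `x ⊕ y` of a distance set `D`: the largest element of `D` that is at most
`x + y`. -/
noncomputable def truncAdd (D : Set ℝ) (x y : ℝ) : ℝ := sSup (D ∩ Set.Iic (x + y))

variable {D : Set ℝ} {x y z s t : ℝ}

theorem le_truncAdd (hD : D.Finite) (hz : z ∈ D) (h : z ≤ x + y) : z ≤ truncAdd D x y :=
  le_csSup (hD.subset Set.inter_subset_left).bddAbove ⟨hz, h⟩

theorem truncAdd_mem_inter (hD : D.Finite) (hx : x ∈ D) (hy : 0 ≤ y) :
    truncAdd D x y ∈ D ∩ Set.Iic (x + y) :=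
  Set.Nonempty.csSup_mem ⟨x, hx, le_add_of_nonneg_right hy⟩ (hD.subset Set.inter_subset_left)

theorem truncAdd_mem (hD : D.Finite) (hx : x ∈ D) (hy : 0 ≤ y) : truncAdd D x y ∈ D :=
  (truncAdd_mem_inter hD hx hy).1

theorem truncAdd_le (hD : D.Finite) (hx : x ∈ D) (hy : 0 ≤ y) : truncAdd D x y ≤ x + y :=
  (truncAdd_mem_inter hD hx hy).2

theorem truncAdd_comm (D : Set ℝ) (x y : ℝ) : truncAdd D x y = truncAdd D y x := by
  rw [truncAdd, truncAdd, add_comm]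

theorem truncAdd_mono (hD : D.Finite) {x' y' : ℝ} (hx : x ∈ D) (hy : 0 ≤ y) (hxx : x ≤ x')
    (hyy : y ≤ y') : truncAdd D x y ≤ truncAdd D x' y' :=
  le_truncAdd hD (truncAdd_mem hD hx hy) ((truncAdd_le hD hx hy).trans (add_le_add hxx hyy))

/-- The triangle inequalities between three numbers. -/
def IsTriangle (x y z : ℝ) : Prop := |x - y| ≤ z ∧ z ≤ x + y

theorem isTriangle_truncAdd (hD : D.Finite) (hx : x ∈ D) (hy : y ∈ D) (hx0 : 0 ≤ x)
    (hy0 : 0 ≤ y) : IsTriangle x y (truncAdd D x y) := by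
  have hxt : x ≤ truncAdd D x y := le_truncAdd hD hx (le_add_of_nonneg_right hy0)
  have hyt : y ≤ truncAdd D x y := le_truncAdd hD hy (le_add_of_nonneg_left hx0)
  exact ⟨abs_sub_le_of_nonneg_of_le hx0 hxt hy0 hyt, truncAdd_le hD hx hy0⟩

/-- The three-point space with points `0`, `1`, `2` and `dist 0 1 = a`, `dist 1 2 = b`,
`dist 0 2 = c`. -/
@[reducible]
def threePointSpace {a b c : ℝ} (ha : 0 ≤ a) (hb : 0 ≤ b) (h : IsTriangle a b c) :
    PseudoMetricSpace (Fin 3) where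
  dist i j := ![![0, a, c], ![a, 0, b], ![c, b, 0]] i j
  dist_self i := by fin_cases i <;> rfl
  dist_comm i j := by fin_cases i <;> fin_cases j <;> rfl
  dist_triangle i j k := by
    obtain ⟨hab, hc⟩ := h
    rw [abs_sub_le_iff] at hab
    fin_cases i <;> fin_cases j <;> fin_cases k <;> simp <;> linarith

/-- The finite distance sets with minimum `0` whose truncated sum is associative. These are the
finite universal sets; associativity is an equivalent form of the four-values condition. -/
structure IsAssocDistSet (D : Set ℝ) : Prop where
  finite : D.Finite
  isLeast_zero : IsLeast D 0
  truncAdd_assoc : ∀ x ∈ D, ∀ y ∈ D, ∀ z ∈ D,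
    truncAdd D (truncAdd D x y) z = truncAdd D x (truncAdd D y z)

namespace IsAssocDistSet

theorem truncAdd_mem (hD : IsAssocDistSet D) (hx : x ∈ D) (hy : y ∈ D) : truncAdd D x y ∈ D :=
  _root_.truncAdd_mem hD.finite hx (hD.isLeast_zero.2 hy)

theorem truncAdd_zero (hD : IsAssocDistSet D) (hx : x ∈ D) : truncAdd D 0 x = x :=
  le_antisymm ((truncAdd_le hD.finite hD.isLeast_zero.1 (hD.isLeast_zero.2 hx)).trans
    (zero_add x).le) (le_truncAdd hD.finite hx (zero_add x).ge)

theorem le_add_truncAdd (hD : IsAssocDistSet D) (hx : x ∈ D) (hy : y ∈ D) (hz : z ∈ D) (hs : s ∈ D)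
    (ht : t ∈ D) (hxy : x ≤ y + s) (hyz : y ≤ z + t) : x ≤ z + truncAdd D s t := by
  have hy_le : y ≤ truncAdd D z t := le_truncAdd hD.finite hy hyz
  calc x ≤ truncAdd D (truncAdd D z t) s :=
        le_truncAdd hD.finite hx (hxy.trans (add_le_add_left hy_le s))
    _ = truncAdd D z (truncAdd D s t) := by
        rw [hD.truncAdd_assoc z hz t ht s hs, truncAdd_comm D t s]
    _ ≤ z + truncAdd D s t :=
        truncAdd_le hD.finite hz (hD.isLeast_zero.2 (hD.truncAdd_mem hs ht))

theorem abs_sub_le_truncAdd (hD : IsAssocDistSet D) (hx : x ∈ D) (hy : y ∈ D) (hz : z ∈ D)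
    (hs : s ∈ D) (ht : t ∈ D) (hxy : |x - y| ≤ s) (hyz : |y - z| ≤ t) :
    |x - z| ≤ truncAdd D s t := by
  rw [abs_sub_le_iff] at *
  refine ⟨sub_le_iff_le_add'.2 ?_, sub_le_iff_le_add'.2 ?_⟩
  · exact hD.le_add_truncAdd hx hy hz hs ht (by linarith) (by linarith)
  · rw [truncAdd_comm]
    exact hD.le_add_truncAdd hz hy hx ht hs (by linarith) (by linarith)

theorem truncAdd_le_truncAdd (hD : IsAssocDistSet D) (hx : x ∈ D) (hy : y ∈ D) (hz : z ∈ D)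
    (ht : t ∈ D) (hxy : truncAdd D x y ≤ s) (hyz : |y - z| ≤ t) :
    truncAdd D x z ≤ truncAdd D s t := by
  have nonneg {r : ℝ} (hr : r ∈ D) : 0 ≤ r := hD.isLeast_zero.2 hr
  have hz_le : z ≤ truncAdd D y t :=
    le_truncAdd hD.finite hz (by linarith [(abs_sub_le_iff.1 hyz).2])
  calc truncAdd D x z ≤ truncAdd D x (truncAdd D y t) :=
        truncAdd_mono hD.finite hx (nonneg hz) le_rfl hz_le
    _ = truncAdd D (truncAdd D x y) t := (hD.truncAdd_assoc x hx y hy t ht).symm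
    _ ≤ truncAdd D s t := truncAdd_mono hD.finite (hD.truncAdd_mem hx hy) (nonneg ht) hxy le_rfl

end IsAssocDistSet

end TruncAdd

namespace IsUrysohnSpace

variable {D : Set ℝ} {M : Type*} [MetricSpace M]

theorem dist_mem (hM : IsUrysohnSpace D M) (x y : M) : dist x y ∈ D :=
  hM.distSet_eq ▸ ⟨x, y, rfl⟩

theorem nonneg_of_mem (hM : IsUrysohnSpace D M) {r : ℝ} (hr : r ∈ D) : 0 ≤ r := by
  rw [← hM.distSet_eq] at hr
  obtain ⟨x, y, rfl⟩ := hr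
  exact dist_nonneg

theorem exists_isometryEquiv (hM : IsUrysohnSpace D M) {ι : Type*} [Finite ι] (u v : ι → M)
    (h : ∀ i j, dist (u i) (u j) = dist (v i) (v j)) : ∃ g : M ≃ᵢ M, ∀ i, g (u i) = v i := by
  choose k hk using fun x : Set.range u => x.2
  obtain ⟨g, hg⟩ := hM.homogeneous (Set.range u) (Set.finite_range u) (fun x => v (k x))
    (Isometry.of_dist_eq fun x y => by rw [← h, hk, hk]; rfl)
  refine ⟨g, fun i => ?_⟩
  rw [hg ⟨u i, i, rfl⟩, ← dist_eq_zero, ← h, hk, dist_self]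

theorem exists_dist_eq_of_finite (hM : IsUrysohnSpace D M) {X : Type} [PseudoMetricSpace X]
    [Finite X] (hX : ∀ x y : X, dist x y ∈ D) :
    ∃ f : X → M, ∀ x y, dist (f x) (f y) = dist x y := by
  have : Finite (SeparationQuotient X) := Finite.of_surjective _ SeparationQuotient.surjective_mk
  obtain ⟨f, hf⟩ := hM.embeds (SeparationQuotient X) (by
    rintro _ ⟨x, y, rfl⟩
    obtain ⟨x, rfl⟩ := SeparationQuotient.surjective_mk x
    obtain ⟨y, rfl⟩ := SeparationQuotient.surjective_mk y
    exact hX x y)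
  exact ⟨fun x => f (SeparationQuotient.mk x), fun x y => by
    rw [hf.dist_eq, SeparationQuotient.dist_mk]⟩

theorem exists_dist_eq_of_countable (hM : IsUrysohnSpace D M) {X : Type} [PseudoMetricSpace X]
    [Countable X] (hX : ∀ x y : X, dist x y ∈ D) :
    ∃ f : X → M, ∀ x y, dist (f x) (f y) = dist x y := by
  obtain ⟨rank, rank_inj⟩ := exists_injective_nat X
  have (n : ℕ) : Finite {x // rank x < n} :=
    Finite.of_injective (fun x => (⟨rank x, x.2⟩ : Fin n)) fun x y h =>
      Subtype.ext (rank_inj (congrArg Fin.val h))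
  choose f hf using fun n =>
    hM.exists_dist_eq_of_finite (X := {x // rank x < n}) fun x y => hX x y
  choose g hg using fun n => hM.exists_isometryEquiv
    (fun x : {x // rank x < n} => f (n + 1) ⟨x, x.2.trans n.lt_succ_self⟩) (f n)
    fun x y => by rw [hf, hf]; rfl
  -- Replacing each `f n` by its image under `e n` makes them extend one another.
  let e (n : ℕ) : M ≃ᵢ M := ((List.range n).map g).prod
  have e_succ (n : ℕ) (x : M) : e (n + 1) x = e n (g n x) :=
    congrArg (· x) (List.prod_range_succ g n)
  let F (x : X) : M := e (rank x + 1) (f (rank x + 1) ⟨x, (rank x).lt_succ_self⟩)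
  have F_eq (n : ℕ) (x : X) (hx : rank x < n) : F x = e n (f n ⟨x, hx⟩) := by
    induction n, Nat.succ_le_of_lt hx using Nat.le_induction with
    | base => rfl
    | succ n hn ih => rw [e_succ, hg n ⟨x, hn⟩, ih hn]
  refine ⟨F, fun x y => ?_⟩
  rw [F_eq (max (rank x) (rank y) + 1) x (Nat.lt_succ_of_le (le_max_left ..)),
    F_eq (max (rank x) (rank y) + 1) y (Nat.lt_succ_of_le (le_max_right ..)),
    IsometryEquiv.dist_eq, hf]
  rfl

theorem exists_dist_eq_of_isTriangle (hM : IsUrysohnSpace D M) {a b : ℝ} (ha : a ∈ D) (hb : b ∈ D)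
    {x z : M} (h : IsTriangle a b (dist x z)) : ∃ y, dist x y = a ∧ dist y z = b := by
  have hcD : dist x z ∈ D := hM.dist_mem x z
  have h0D : (0 : ℝ) ∈ D := by simpa using hM.dist_mem x x
  let := threePointSpace (hM.nonneg_of_mem ha) (hM.nonneg_of_mem hb) h
  obtain ⟨f, hf⟩ := hM.exists_dist_eq_of_finite (X := Fin 3) fun i j => by
    fin_cases i <;> fin_cases j <;> first | exact h0D | exact ha | exact hb | exact hcD
  have hf02 : dist (f 0) (f 2) = dist x z := hf 0 2
  obtain ⟨g, hg⟩ := hM.exists_isometryEquiv ![f 0, f 2] ![x, z] fun i j => by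
    fin_cases i <;> fin_cases j <;> simp [hf02, dist_comm (f 2), dist_comm z]
  refine ⟨g (f 1), ?_, ?_⟩
  · rw [← show g (f 0) = x from hg 0, g.dist_eq, hf]; rfl
  · rw [← show g (f 2) = z from hg 1, g.dist_eq, hf]; rfl

theorem truncAdd_assoc_le (hM : IsUrysohnSpace D M) (hD : D.Finite) {a b c : ℝ} (ha : a ∈ D)
    (hb : b ∈ D) (hc : c ∈ D) :
    truncAdd D (truncAdd D a b) c ≤ truncAdd D a (truncAdd D b c) := by
  have nonneg {r : ℝ} (hr : r ∈ D) : 0 ≤ r := hM.nonneg_of_mem hr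
  have hab : truncAdd D a b ∈ D := truncAdd_mem hD ha (nonneg hb)
  have habc : truncAdd D (truncAdd D a b) c ∈ D := truncAdd_mem hD hab (nonneg hc)
  obtain ⟨x, w, hxw⟩ : truncAdd D (truncAdd D a b) c ∈ distSet M := hM.distSet_eq ▸ habc
  obtain ⟨z, hxz, hzw⟩ := hM.exists_dist_eq_of_isTriangle hab hc
    (hxw ▸ isTriangle_truncAdd hD hab hc (nonneg hab) (nonneg hc))
  obtain ⟨y, hxy, hyz⟩ := hM.exists_dist_eq_of_isTriangle ha hb
    (hxz ▸ isTriangle_truncAdd hD ha hb (nonneg ha) (nonneg hb))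
  have hyw : dist y w ≤ truncAdd D b c :=
    le_truncAdd hD (hM.dist_mem y w) ((dist_triangle y z w).trans_eq (by rw [hyz, hzw]))
  refine le_truncAdd hD habc ?_
  calc truncAdd D (truncAdd D a b) c = dist x w := hxw.symm
    _ ≤ dist x y + dist y w := dist_triangle x y w
    _ ≤ a + truncAdd D b c := add_le_add hxy.le hyw

theorem isAssocDistSet [Nonempty M] (hM : IsUrysohnSpace D M) (hD : D.Finite) :
    IsAssocDistSet D where
  finite := hD
  isLeast_zero :=
    ⟨Nonempty.elim ‹_› fun x : M => dist_self x ▸ hM.dist_mem x x, fun _ => hM.nonneg_of_mem⟩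
  truncAdd_assoc a ha b hb c hc := by
    refine le_antisymm (hM.truncAdd_assoc_le hD ha hb hc) ?_
    rw [truncAdd_comm D a, truncAdd_comm D b, truncAdd_comm D _ c, truncAdd_comm D a]
    exact hM.truncAdd_assoc_le hD hc hb ha

end IsUrysohnSpace

/-! ### A pseudometric on words -/

section WordDist

variable {D : Set ℝ}

/-- The letter of `u` at position `k`, counted from `0`. Positions behind the end of `u` carry the
letter `0`. -/
def letter (u : FreeMonoid D) (k : ℕ) : ℝ := (u.toList.map (↑)).getD k 0

theorem letter_mem (h0 : (0 : ℝ) ∈ D) (u : FreeMonoid D) (k : ℕ) : letter u k ∈ D := by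
  rw [letter, List.getD_eq_getElem?_getD, List.getElem?_map]
  cases u.toList[k]? with
  | none => exact h0
  | some x => exact x.2

theorem letter_length (u : FreeMonoid D) : letter u u.length = 0 :=
  List.getD_eq_default _ _ (by rw [List.length_map, FreeMonoid.length])

/-- Two words are `c`-compatible if they have the same length and if letters at the same position
can be the distances of a point from two points at distance `c` of each other. -/
def IsCompatible (c : ℝ) (u v : FreeMonoid D) : Prop :=
  List.Forall₂ (fun x y : D => IsTriangle x y c) u.toList v.toList

theorem IsCompatible.mul {c : ℝ} {u u' v v' : FreeMonoid D} (h : IsCompatible c u v)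
    (h' : IsCompatible c u' v') : IsCompatible c (u * u') (v * v') :=
  List.rel_append h h'

theorem IsCompatible.isTriangle {c : D} (hc : (0 : ℝ) ≤ c) {u v : FreeMonoid D}
    (h : IsCompatible c u v) (t : FreeMonoid D) {k : ℕ} (hk : k ≤ u.length) :
    IsTriangle (letter u k) (letter (v * of c * t) k) c := by
  rw [letter, letter, mul_assoc, toList_mul, toList_of_mul]
  change k ≤ u.toList.length at hk
  unfold IsCompatible at h
  generalize u.toList = x, v.toList = y at h hk ⊢
  induction h generalizing k with
  | nil =>
    obtain rfl := Nat.le_zero.1 hk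
    simp [IsTriangle, abs_of_nonneg hc]
  | cons hxy _ ih =>
    cases k with
    | zero => exact hxy
    | succ k => exact ih (Nat.le_of_succ_le_succ hk)

/-- `s` is at least the distance that `wordDist D` should give to `u` and `v`. With `⊕` denoting
truncated addition, this distance is the minimum over `k` of the maximum of `u k ⊕ v k` and of all
`|u j - v j|` for `j ≤ k`. -/
def IsWordBound (D : Set ℝ) (u v : FreeMonoid D) (s : ℝ) : Prop :=
  ∃ k, truncAdd D (letter u k) (letter v k) ≤ s ∧ ∀ j ≤ k, |letter u j - letter v j| ≤ s

theorem IsWordBound.symm {u v : FreeMonoid D} {s : ℝ} (h : IsWordBound D u v s) :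
    IsWordBound D v u s := by
  obtain ⟨k, hk, hj⟩ := h
  exact ⟨k, truncAdd_comm D _ _ ▸ hk, fun j hjk => abs_sub_comm (letter u j) _ ▸ hj j hjk⟩

namespace IsAssocDistSet

theorem letter_mem (hD : IsAssocDistSet D) (u : FreeMonoid D) (k : ℕ) : letter u k ∈ D :=
  _root_.letter_mem hD.isLeast_zero.1 u k

theorem isWordBound_self (hD : IsAssocDistSet D) (u : FreeMonoid D) : IsWordBound D u u 0 :=
  ⟨u.length, by rw [letter_length, hD.truncAdd_zero hD.isLeast_zero.1], fun j _ => by simp⟩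

theorem exists_isWordBound (hD : IsAssocDistSet D) (u v : FreeMonoid D) :
    ∃ s ∈ D, IsWordBound D u v s := by
  refine ⟨_, hD.truncAdd_mem (hD.letter_mem u 0) (hD.letter_mem v 0), 0, le_rfl, fun j hj => ?_⟩
  obtain rfl := Nat.le_zero.1 hj
  exact (isTriangle_truncAdd hD.finite (hD.letter_mem u 0) (hD.letter_mem v 0)
    (hD.isLeast_zero.2 (hD.letter_mem u 0)) (hD.isLeast_zero.2 (hD.letter_mem v 0))).1

theorem isWordBound_truncAdd (hD : IsAssocDistSet D) {u v w : FreeMonoid D} {s t : ℝ} (hs : s ∈ D)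
    (ht : t ∈ D) (huv : IsWordBound D u v s) (hvw : IsWordBound D v w t) :
    IsWordBound D u w (truncAdd D s t) := by
  obtain ⟨k, huv, huv'⟩ := huv
  obtain ⟨l, hvw, hvw'⟩ := hvw
  refine ⟨min k l, ?_, fun j hj => ?_⟩
  · rcases le_total k l with hkl | hlk
    · rw [min_eq_left hkl]
      exact hD.truncAdd_le_truncAdd (hD.letter_mem u k) (hD.letter_mem v k) (hD.letter_mem w k) ht
        huv (hvw' k hkl)
    · rw [min_eq_right hlk, truncAdd_comm D s, truncAdd_comm D (letter u l)]
      exact hD.truncAdd_le_truncAdd (hD.letter_mem w l) (hD.letter_mem v l) (hD.letter_mem u l) hs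
        (truncAdd_comm D _ _ ▸ hvw) (abs_sub_comm (letter u l) _ ▸ huv' l hlk)
  · exact hD.abs_sub_le_truncAdd (hD.letter_mem u j) (hD.letter_mem v j) (hD.letter_mem w j) hs ht
      (huv' j (hj.trans (min_le_left k l))) (hvw' j (hj.trans (min_le_right k l)))

end IsAssocDistSet

/-- The distance of two words; see `IsWordBound` for a formula. -/
noncomputable def wordDist (D : Set ℝ) (u v : FreeMonoid D) : ℝ :=
  sInf {s ∈ D | IsWordBound D u v s}

theorem wordDist_comm (D : Set ℝ) (u v : FreeMonoid D) : wordDist D u v = wordDist D v u :=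
  congrArg sInf <| Set.ext fun _ => and_congr_right fun _ => ⟨IsWordBound.symm, IsWordBound.symm⟩

theorem IsAssocDistSet.isLeast_wordDist (hD : IsAssocDistSet D) (u v : FreeMonoid D) :
    IsLeast {s ∈ D | IsWordBound D u v s} (wordDist D u v) := by
  have hfin : {s ∈ D | IsWordBound D u v s}.Finite := hD.finite.subset (Set.sep_subset ..)
  exact ⟨Set.Nonempty.csInf_mem (hD.exists_isWordBound u v) hfin, fun s hs =>
    csInf_le hfin.bddBelow hs⟩

/-- The pseudometric `wordDist` on words. -/
@[reducible]
noncomputable def IsAssocDistSet.wordSpace (hD : IsAssocDistSet D) :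
    PseudoMetricSpace (FreeMonoid D) where
  dist := wordDist D
  dist_self u := IsLeast.unique (hD.isLeast_wordDist u u)
    ⟨⟨hD.isLeast_zero.1, hD.isWordBound_self u⟩, fun s hs => hD.isLeast_zero.2 hs.1⟩
  dist_comm := wordDist_comm D
  dist_triangle u v w := by
    have huv := (hD.isLeast_wordDist u v).1
    have hvw := (hD.isLeast_wordDist v w).1
    exact ((hD.isLeast_wordDist u w).2 ⟨hD.truncAdd_mem huv.1 hvw.1,
      hD.isWordBound_truncAdd huv.1 hvw.1 huv.2 hvw.2⟩).trans
      (truncAdd_le hD.finite huv.1 (hD.isLeast_zero.2 hvw.1))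

theorem IsAssocDistSet.wordDist_eq_of_isCompatible (hD : IsAssocDistSet D) {c : D}
    {u v : FreeMonoid D} (h : IsCompatible c u v) (t : FreeMonoid D) :
    wordDist D u (v * of c * t) = c := by
  set v' := v * of c * t
  have hc : (0 : ℝ) ≤ c := hD.isLeast_zero.2 c.2
  have triangle {k : ℕ} (hk : k ≤ u.length) : IsTriangle (letter u k) (letter v' k) c :=
    h.isTriangle hc t hk
  have letter_c : letter v' u.length = c := by
    obtain ⟨hle, hge⟩ := triangle le_rfl
    rw [letter_length, zero_sub, abs_neg] at hle
    exact le_antisymm ((le_abs_self _).trans hle) (by simpa [letter_length] using hge)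
  refine (hD.isLeast_wordDist u v').unique ⟨⟨c.2, u.length, ?_, fun j hj => (triangle hj).1⟩, ?_⟩
  · rw [letter_length, letter_c, hD.truncAdd_zero c.2]
  · rintro s ⟨-, k, hk, hj⟩
    rcases le_total k u.length with hku | huk
    · exact (le_truncAdd hD.finite c.2 (triangle hku).2).trans hk
    · simpa [letter_length, letter_c, abs_of_nonneg hc] using hj u.length huk

theorem IsUrysohnSpace.exists_wordMap {M : Type*} [MetricSpace M] [Nonempty M]
    (hM : IsUrysohnSpace D M) (hD : D.Finite) : ∃ Ψ : FreeMonoid D → M,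
      ∀ (c : D) (u v t : FreeMonoid D), IsCompatible c u v → dist (Ψ u) (Ψ (v * of c * t)) = c := by
  have hD' := hM.isAssocDistSet hD
  let := hD'.wordSpace
  have := hD.to_subtype
  have : Countable (FreeMonoid D) := inferInstanceAs (Countable (List D))
  obtain ⟨Ψ, hΨ⟩ := hM.exists_dist_eq_of_countable fun u v : FreeMonoid D =>
    (hD'.isLeast_wordDist u v).1.1
  exact ⟨Ψ, fun c u v t h => (hΨ _ _).trans (hD'.wordDist_eq_of_isCompatible h t)⟩

end WordDist

/-! ### Monochromatic copies -/

section Indivisible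

variable {D : Set ℝ}

theorem subtype_coe_max {α : Type*} [LinearOrder α] {p : α → Prop} (x y : Subtype p) :
    ((max x y : Subtype p) : α) = max (x : α) y :=
  (Subtype.mono_coe p).map_max

theorem isCompatible_raise_raise {x y : D} {c : ℝ} (h : IsTriangle x y c) (w : FreeMonoid D) :
    IsCompatible c (raise x w) (raise y w) := by
  rw [IsCompatible, raise, raise, toList_map, toList_map, List.forall₂_map_left_iff,
    List.forall₂_map_right_iff, List.forall₂_same]
  intro z _
  rw [subtype_coe_max, subtype_coe_max]
  exact ⟨(abs_max_sub_max_le_abs _ _ _).trans h.1,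
    h.2.trans (add_le_add (le_max_left _ _) (le_max_left _ _))⟩

theorem isCompatible_raise (h0 : ∀ x ∈ D, 0 ≤ x) (c : D) (w : FreeMonoid D) :
    IsCompatible c w (raise c w) := by
  rw [IsCompatible, raise, toList_map, List.forall₂_map_right_iff, List.forall₂_same]
  intro z _
  have hc := h0 c c.2
  have hz := h0 z z.2
  rw [subtype_coe_max, IsTriangle, abs_sub_le_iff]
  exact ⟨⟨by linarith [le_max_right (c : ℝ) z], by linarith [max_le_add_of_nonneg hc hz]⟩,
    (le_max_left (c : ℝ) z).trans (le_add_of_nonneg_left hz)⟩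

theorem isCompatible_raisedProd (v : ℕ → FreeMonoid D) {a a' : ℕ → D} {c : ℝ}
    (h : ∀ i, IsTriangle (a i) (a' i) c) (n : ℕ) :
    IsCompatible c (raisedProd v a n) (raisedProd v a' n) := by
  induction n with
  | zero => exact List.Forall₂.nil
  | succ n ih => exact ih.mul (isCompatible_raise_raise (h n) (v n))

namespace IsUrysohnSpace

variable {M : Type*} [MetricSpace M]

theorem isCompatible_raisedProd_mul_raise (hM : IsUrysohnSpace D M) {p : ℕ → M} {δ : ℕ → ℕ → D}
    (hδ : ∀ i j, (δ i j : ℝ) = dist (p i) (p j)) (v : ℕ → FreeMonoid D) (j k n : ℕ)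
    (w : FreeMonoid D) :
    IsCompatible (δ k j) (raisedProd v (δ j) n * w) (raisedProd v (δ k) n * raise (δ k j) w) := by
  refine (isCompatible_raisedProd v (fun i => ?_) n).mul
    (isCompatible_raise (fun _ => hM.nonneg_of_mem) _ w)
  rw [hδ, hδ, hδ, dist_comm (p k) (p j)]
  exact ⟨abs_dist_sub_le (p j) (p k) (p i), dist_triangle_right (p j) (p k) (p i)⟩

theorem exists_dist_eq_and_monochromatic [Nonempty M] (hM : IsUrysohnSpace D M) (hD : D.Finite)
    {κ : Type*} [Finite κ] (χ : M → κ) (p : ℕ → M) :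
    ∃ f : ℕ → M, (∀ j k, dist (f j) (f k) = dist (p j) (p k)) ∧ ∀ j k, χ (f j) = χ (f k) := by
  have := hD.to_subtype
  have hD' := hM.isAssocDistSet hD
  let b : D := ⟨0, hD'.isLeast_zero.1⟩
  have hb : IsBot b := fun x => hD'.isLeast_zero.2 x.2
  let δ (i j : ℕ) : D := ⟨dist (p i) (p j), hM.dist_mem _ _⟩
  obtain ⟨Ψ, hΨ⟩ := hM.exists_wordMap hD
  obtain ⟨i, s, r, hi⟩ := exists_monochromatic_raisedProd_mul hb (χ ∘ Ψ)
  let V (n : ℕ) : FreeMonoid D := raisedProd (fun k => s k * of b * r k) (δ n) n * s n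
  have dist_V {j k : ℕ} (h : j < k) : dist (Ψ (V j)) (Ψ (V k)) = dist (p k) (p j) := by
    obtain ⟨t, ht⟩ := exists_raisedProd_mul_eq hb s r (δ k) h
    rw [show V k = _ from ht]
    exact hΨ (δ k j) _ _ t (hM.isCompatible_raisedProd_mul_raise (fun _ _ => rfl) _ j k j (s j))
  refine ⟨fun n => Ψ (V n), fun j k => ?_, fun j k => (hi j (δ j)).trans (hi k (δ k)).symm⟩
  rcases lt_trichotomy j k with h | rfl | h
  · rw [dist_V h, dist_comm]
  · rw [dist_self, dist_self]
  · rw [dist_comm, dist_V h]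

theorem exists_isCopyIn_monochromatic [Countable M] (hM : IsUrysohnSpace D M) (hD : D.Finite)
    {κ : Type*} [Finite κ] (χ : M → κ) :
    ∃ C, IsCopyIn M C ∧ ∀ x ∈ C, ∀ y ∈ C, χ x = χ y := by
  rcases isEmpty_or_nonempty M with hE | hE
  · exact ⟨Set.range id, ⟨id, isometry_id, rfl⟩, fun x => isEmptyElim x⟩
  obtain ⟨p, hp⟩ := exists_surjective_nat M
  obtain ⟨f, hf, hχ⟩ := hM.exists_dist_eq_and_monochromatic hD χ p
  choose index hindex using hp
  refine ⟨_, ⟨fun x => f (index x), Isometry.of_dist_eq fun x y => ?_, rfl⟩, ?_⟩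
  · rw [hf, hindex, hindex]
  · rintro _ ⟨x, rfl⟩ _ ⟨y, rfl⟩
    exact hχ _ _

end IsUrysohnSpace

end Indivisible

/-! ### Blocks -/

section Block

theorem isLeast_range_of_monotone_fin {α : Type*} [Preorder α] {n : ℕ} {b : Fin (n + 1) → α}
    (hb : Monotone b) : IsLeast (Set.range b) (b 0) :=
  ⟨Set.mem_range_self 0, Set.forall_mem_range.2 fun i => hb (Fin.zero_le i)⟩

theorem isGreatest_range_of_monotone_fin {α : Type*} [Preorder α] {n : ℕ} {b : Fin (n + 1) → α}
    (hb : Monotone b) : IsGreatest (Set.range b) (b (Fin.last n)) :=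
  ⟨Set.mem_range_self _, Set.forall_mem_range.2 fun i => hb (Fin.le_last i)⟩

variable {D B : Set ℝ} {a m : ℝ}

theorem IsBlockSegment.insert {s : ℝ} (hB : IsBlockSegment D B) (ha : IsLeast B a)
    (hm : IsGreatest B m) (hs : IsNextIn D m s) (hsa : s ≤ m + a) :
    IsBlockSegment D (insert s B) := by
  obtain ⟨hBD, n, b, rfl, hb0, hprev, hlt, hnext, hle⟩ := hB
  have hmono : StrictMono b := Fin.strictMono_iff_lt_succ.2 hlt
  obtain rfl := ha.unique (isLeast_range_of_monotone_fin hmono.monotone)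
  obtain rfl := hm.unique (isGreatest_range_of_monotone_fin hmono.monotone)
  let b' : Fin (n + 2) → ℝ := Fin.snoc b s
  have cast_eq (i : Fin (n + 1)) : b' i.castSucc = b i := Fin.snoc_castSucc ..
  have last_eq : b' (Fin.last (n + 1)) = s := Fin.snoc_last ..
  have zero_eq : b' 0 = b 0 := cast_eq 0
  have forall_step {P : ℝ → ℝ → Prop} (hlast : P (b (Fin.last n)) s)
      (hcast : ∀ i : Fin n, P (b i.castSucc) (b i.succ)) (i : Fin (n + 1)) :
      P (b' i.castSucc) (b' i.succ) := by
    rw [cast_eq]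
    induction i using Fin.lastCases with
    | last => rwa [Fin.succ_last, last_eq]
    | cast i => rw [Fin.succ_castSucc, cast_eq]; exact hcast i
  refine ⟨Set.insert_subset hs.1.1 hBD, n + 1, b', Fin.range_snoc .., zero_eq ▸ hb0,
    zero_eq ▸ hprev, forall_step (P := (· < ·)) hs.1.2 hlt, forall_step hs hnext, ?_⟩
  rw [zero_eq]
  exact forall_step (P := fun x y => y ≤ x + b 0) hsa hle

theorem IsBlock.add_lt_of_lt (hD : D.Finite) (hB : IsBlock D B) (ha : IsLeast B a)
    (hm : IsGreatest B m) {r : ℝ} (hr : r ∈ D) (hmr : m < r) : m + a < r := by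
  by_contra! hle
  obtain ⟨s, ⟨hsD, hms⟩, hs⟩ := Set.exists_min_image (D ∩ Set.Ioi m) id
    (hD.subset Set.inter_subset_left) ⟨r, hr, hmr⟩
  have hseg : IsBlockSegment D (insert s B) :=
    hB.prop.insert ha hm ⟨⟨hsD, hms⟩, hs⟩ ((hs r ⟨hr, hmr⟩).trans hle)
  have hsB : s ∈ B := hB.le_of_ge hseg (Set.subset_insert s B) (Set.mem_insert s B)
  exact (hm.2 hsB).not_gt hms

theorem IsAssocDistSet.truncAdd_le_of_isBlock (hD : IsAssocDistSet D) (hB : IsBlock D B)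
    (hm : IsGreatest B m) : truncAdd D m m ≤ m := by
  obtain ⟨hBD, n, b, rfl, -, -, hlt, -, hle⟩ := hB.prop
  have hmono : StrictMono b := Fin.strictMono_iff_lt_succ.2 hlt
  have hmD : m ∈ D := hBD hm.1
  have hbD (i : Fin (n + 1)) : b i ∈ D := hBD ⟨i, rfl⟩
  have nonneg (i : Fin (n + 1)) : 0 ≤ b i := hD.isLeast_zero.2 (hbD i)
  have add_zero_le : truncAdd D m (b 0) ≤ m := not_lt.1 fun h =>
    (hB.add_lt_of_lt hD.finite (isLeast_range_of_monotone_fin hmono.monotone) hm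
      (hD.truncAdd_mem hmD (hbD 0)) h).not_ge (truncAdd_le hD.finite hmD (nonneg 0))
  have add_le (i : Fin (n + 1)) : truncAdd D m (b i) ≤ m := by
    induction i using Fin.induction with
    | zero => exact add_zero_le
    | succ i ih =>
      calc truncAdd D m (b i.succ) ≤ truncAdd D m (truncAdd D (b i.castSucc) (b 0)) :=
            truncAdd_mono hD.finite hmD (nonneg _) le_rfl (le_truncAdd hD.finite (hbD _) (hle i))
        _ = truncAdd D (truncAdd D m (b i.castSucc)) (b 0) :=
            (hD.truncAdd_assoc _ hmD _ (hbD _) _ (hbD 0)).symm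
        _ ≤ truncAdd D m (b 0) :=
            truncAdd_mono hD.finite (hD.truncAdd_mem hmD (hbD _)) (nonneg 0) ih le_rfl
        _ ≤ m := add_zero_le
  obtain ⟨i, rfl⟩ := hm.1
  exact add_le i

theorem IsUrysohnSpace.equivalence_dist_le {M : Type*} [MetricSpace M] (hM : IsUrysohnSpace D M)
    (hD : D.Finite) (hB : IsBlock D B) (hm : IsGreatest B m) :
    Equivalence fun x y : M => dist x y ≤ m where
  refl x := (dist_self x).trans_le (hM.nonneg_of_mem (hB.prop.1 hm.1))
  symm {x y} h := (dist_comm y x).trans_le h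
  trans {x y z} hxy hyz := by
    have : Nonempty M := ⟨x⟩
    calc dist x z ≤ truncAdd D m m :=
          le_truncAdd hD (hM.dist_mem x z) ((dist_triangle x y z).trans (add_le_add hxy hyz))
      _ ≤ m := (hM.isAssocDistSet hD).truncAdd_le_of_isBlock hB hm

end Block

theorem lemma9p2_general {D : Set ℝ} (hD : D.Finite) {B : Set ℝ} (hB : IsBlock D B) {m : ℝ}
    (hm : IsGreatest B m) {M : Type*} [MetricSpace M] [Countable M] (hM : IsUrysohnSpace D M) :
    Equivalence (fun x y : M => dist x y ≤ m) ∧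
      ∀ {κ : Type*} [Finite κ] (χ : M → κ), ∃ C, IsCopyIn M C ∧ ∀ x ∈ C, ∀ y ∈ C, χ x = χ y :=
  ⟨hM.equivalence_dist_le hD hB hm, fun χ => hM.exists_isCopyIn_monochromatic hD χ⟩

theorem lemma9p2 (D : Set ℝ) (hDfin : D.Finite)
    (B : Set ℝ) (hB : IsBlock D B)
    (a : ℝ) (hDmin : IsLeast (D \ {0}) a) (hBmin : IsLeast B a)
    (m : ℝ) (hBmax : IsGreatest B m)
    (hTwo : ∃ B₁ B₂ : Set ℝ, IsBlock D B₁ ∧ IsBlock D B₂ ∧ B₁ ≠ B₂)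
    (M : Type*) [MetricSpace M] [Countable M] (hM : IsUrysohnSpace D M) :
    Equivalence (fun x y : M => dist x y ≤ m) ∧
      ∀ χ : M → Fin 2, ∃ C : Set M, IsCopyIn M C ∧
        ∀ x ∈ C, ∃ i : Fin 2, ∀ y ∈ C, dist x y ≤ m → χ y = i := by
  obtain ⟨hE, hχ⟩ := lemma9p2_general hDfin hB hBmax hM
  exact ⟨hE, fun χ => (hχ χ).imp fun C hC =>
    ⟨hC.1, fun x hx => ⟨χ x, fun y hy _ => hC.2 y hy x hx⟩⟩⟩
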